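/- Let $n,d,\alpha,\beta$ be non-negative integers. A finite simple graph is called amply regular with parameter $(n,d,\alpha,\beta)$ if it is a $d$-regular graph on $n$ vertices such that any two adjacent vertices have exactly $\alpha$ common neighbors and any two vertices at distance $2$ have exactly $\beta$ common neighbors. Let $G$ be a connected amply regular graph with parameter $(n,d,\alpha,\beta)$. (i) If $1\neq\beta\geq\alpha$, then $\mathrm{diam}(G)\leq d$. (ii) If $\beta>\alpha\geq 1$, then $\mathrm{diam}(G)\leq\left\lfloor\frac{2}{3}d\right\rfloor$. -/

import Mathlib

/-- A finite simple graph `G` is amply regular with parameter `(n, d, α, β)` if it is a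
`d`-regular graph on `n` vertices such that any two adjacent vertices have exactly `α` common
neighbors and any two vertices at distance `2` have exactly `β` common neighbors. -/
structure SimpleGraph.IsAmplyRegularWith {V : Type*} [Fintype V] [DecidableEq V]
    (G : SimpleGraph V) [DecidableRel G.Adj] (n d α β : ℕ) : Prop where
  card : Fintype.card V = n
  regular : G.IsRegularOfDegree d
  of_adj : ∀ v w : V, G.Adj v w → Fintype.card (G.commonNeighbors v w) = α
  of_dist_eq_two : ∀ v w : V, G.dist v w = 2 → Fintype.card (G.commonNeighbors v w) = β

/-! Each edge `x y` has Lin–Lu–Yau curvature at least `2 / d` (respectively `3 / d`), and the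
discrete Bonnet–Myers argument turns this into a bound on the diameter. Only the easy half of Kantorovich
duality is needed, so everything is phrased through an integer function `f` that increases by at
most `1` along edges.

Put `X = N(x) \ {y}` and `Y = N(y) \ {x}`. In the bipartite multigraph between `X` and `Y` made of
the edges of `G`, together with `β - α` copies of the identity edge at each common neighbour of `x`
and `y`, every vertex has degree `β - 1`. Moving mass `1 / (β - 1)` along each edge is therefore a
transport plan between the uniform distributions on `X` and `Y`; the identity edges are free, whence
`(β - 1) (∑_Y f - ∑_X f) ≤ (β - 1) (d - 1) - α (β - α)`, which is
`sub_one_mul_sum_sub_sum_le`. So `∑_Y f - ∑_X f ≤ d - 1` when `β ≥ 2`, and it is at most `d - 2`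
when `β > α ≥ 1`, because `α (β - α) ≥ β - 1` then. When `β = 0`, both `X` and `Y`
are empty and `d = 1`.

Now take `f = dist u`. Each step away from `u` along a geodesic increases `∑_{w ∼ v} f w` by at most
`d - c`, where `c = 2` or `c = 3`. This sum is `d` at `v = u`, and it is at least `d (L - 1)` at a
vertex at distance `L` from `u`, hence `c L ≤ 2 d` (`mul_dist_le_two_mul`). -/

namespace SimpleGraph

open Finset

lemma dist_eq_two_of_adj_of_adj {V : Type*} {G : SimpleGraph V} {x y u : V}
    (hxy : G.Adj x y) (hxu : G.Adj x u) (huy : u ≠ y) (h : ¬ G.Adj u y) : G.dist u y = 2 := by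
  have h₂ : G.dist u y ≤ 2 := dist_le (Walk.cons hxu.symm (Walk.cons hxy Walk.nil))
  have h₀ : 0 < G.dist u y := Reachable.pos_dist_of_ne ⟨Walk.cons hxu.symm hxy.toWalk⟩ huy
  have h₁ : G.dist u y ≠ 1 := fun h' => h (dist_eq_one_iff_adj.mp h')
  omega

variable {V : Type*} [Fintype V] [DecidableEq V] {G : SimpleGraph V} [DecidableRel G.Adj]

namespace IsAmplyRegularWith

variable {n d α β : ℕ}

/-- The number of edges from a vertex `u` of `N(x) \ {y}` to `N(y) \ {x}`: these are the common
neighbours of `u` and `y` other than `x`. -/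
lemma card_filter_adj_erase (hA : G.IsAmplyRegularWith n d α β) {x y u : V} (hxy : G.Adj x y)
    (hu : u ∈ (G.neighborFinset x).erase y) :
    (#{v ∈ (G.neighborFinset y).erase x | G.Adj u v} : ℤ) =
      (β - 1) - if G.Adj u y then (β - α : ℤ) else 0 := by
  simp only [mem_erase, mem_neighborFinset] at hu
  obtain ⟨huy, hxu⟩ := hu
  have hset : {v ∈ (G.neighborFinset y).erase x | G.Adj u v} =
      (G.commonNeighbors u y).toFinset.erase x := by
    ext v
    simp only [mem_filter, mem_erase, mem_neighborFinset, Set.mem_toFinset, mem_commonNeighbors]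
    tauto
  have hx : x ∈ (G.commonNeighbors u y).toFinset := by
    simp [mem_commonNeighbors, hxu.symm, hxy.symm]
  have hcard := card_erase_add_one hx
  rw [← hset, Set.toFinset_card] at hcard
  split_ifs with h
  · rw [hA.of_adj u y h] at hcard
    omega
  · rw [hA.of_dist_eq_two u y (dist_eq_two_of_adj_of_adj hxy hxu huy h)] at hcard
    omega

/-- Summing `g` over the edges from `N(x) \ {y}` to `N(y) \ {x}`: every vertex counts `β - 1` times,
except that a common neighbour of `x` and `y` counts `β - α` times less. -/
lemma sum_card_filter_adj_mul (hA : G.IsAmplyRegularWith n d α β) {x y : V} (hxy : G.Adj x y)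
    (g : V → ℤ) :
    ∑ u ∈ (G.neighborFinset x).erase y, (#{v ∈ (G.neighborFinset y).erase x | G.Adj u v} : ℤ) * g u
      = (β - 1) * ∑ u ∈ (G.neighborFinset x).erase y, g u
        - (β - α) * ∑ u ∈ (G.commonNeighbors x y).toFinset, g u := by
  have hset : (G.commonNeighbors x y).toFinset =
      {u ∈ (G.neighborFinset x).erase y | G.Adj u y} := by
    ext u
    simp only [mem_filter, mem_erase, mem_neighborFinset, Set.mem_toFinset, mem_commonNeighbors,
      G.adj_comm u y]
    exact ⟨fun h => ⟨⟨h.2.ne', h.1⟩, h.2⟩, fun h => ⟨h.1.2, h.2⟩⟩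
  rw [hset, sum_filter, mul_sum, mul_sum, ← sum_sub_distrib]
  refine sum_congr rfl fun u hu => ?_
  rw [hA.card_filter_adj_erase hxy hu]
  split_ifs <;> ring

lemma card_neighborFinset_erase (hA : G.IsAmplyRegularWith n d α β) {x y : V} (hxy : G.Adj x y) :
    (#((G.neighborFinset x).erase y) : ℤ) = d - 1 := by
  have h := card_erase_add_one ((G.mem_neighborFinset x y).mpr hxy)
  rw [card_neighborFinset_eq_degree, hA.regular x] at h
  omega

/-- The cost estimate for the fractional transport plan, with denominators cleared. -/
lemma sub_one_mul_sum_sub_sum_le (hA : G.IsAmplyRegularWith n d α β) {x y : V} (hxy : G.Adj x y)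
    {f : V → ℤ} (hf : ∀ u v, G.Adj u v → f v ≤ f u + 1) :
    ((β : ℤ) - 1) * (∑ v ∈ (G.neighborFinset y).erase x, f v
        - ∑ u ∈ (G.neighborFinset x).erase y, f u)
      ≤ (β - 1) * (d - 1) - (β - α) * α := by
  have hX := hA.sum_card_filter_adj_mul hxy (fun u => f u + 1)
  have hY := hA.sum_card_filter_adj_mul hxy.symm f
  -- Compare the two ways of summing over the edges between the two sets.
  have hle : ∑ v ∈ (G.neighborFinset y).erase x,
        (#{u ∈ (G.neighborFinset x).erase y | G.Adj v u} : ℤ) * f v ≤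
      ∑ u ∈ (G.neighborFinset x).erase y,
        (#{v ∈ (G.neighborFinset y).erase x | G.Adj u v} : ℤ) * (f u + 1) := by
    simp only [← nsmul_eq_mul, ← sum_const, sum_filter]
    rw [sum_comm]
    refine sum_le_sum fun u _ => sum_le_sum fun v _ => ?_
    by_cases h : G.Adj u v
    · simpa [h, h.symm] using hf u v h
    · have h' : ¬ G.Adj v u := fun h' => h h'.symm
      simp [h, h']
  have hΔ : (#(G.commonNeighbors x y).toFinset : ℤ) = α := by
    rw [Set.toFinset_card, hA.of_adj x y hxy]
  have hsymm : (G.commonNeighbors y x).toFinset = (G.commonNeighbors x y).toFinset := by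
    simp only [commonNeighbors_symm]
  rw [sum_add_distrib, sum_add_distrib, sum_const, sum_const, nsmul_eq_mul, nsmul_eq_mul, hΔ,
    hA.card_neighborFinset_erase hxy] at hX
  rw [hsymm] at hY
  linarith

lemma sum_erase_sub_sum_erase_le_sub_one (hA : G.IsAmplyRegularWith n d α β) (hβ : β ≠ 1)
    (hαβ : α ≤ β) {x y : V} (hxy : G.Adj x y) {f : V → ℤ}
    (hf : ∀ u v, G.Adj u v → f v ≤ f u + 1) :
    ∑ v ∈ (G.neighborFinset y).erase x, f v - ∑ u ∈ (G.neighborFinset x).erase y, f u ≤ d - 1 := by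
  have h := hA.sub_one_mul_sum_sub_sum_le hxy hf
  obtain rfl | hβ₂ : β = 0 ∨ 2 ≤ β := by omega
  · -- With `β = 0` the degree count is impossible, so both sets are empty.
    obtain rfl : α = 0 := by omega
    have hempty : ∀ {a b : V}, G.Adj a b → (G.neighborFinset a).erase b = ∅ := fun hab =>
      eq_empty_of_forall_notMem fun u hu => by
        have := hA.card_filter_adj_erase hab hu
        simp only [CharP.cast_eq_zero, sub_self, ite_self] at this
        omega
    rw [← hA.card_neighborFinset_erase hxy, hempty hxy, hempty hxy.symm]
    simp
  · have h₀ : (0 : ℤ) ≤ (β - α) * α := mul_nonneg (by omega) (by omega)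
    exact le_of_mul_le_mul_left (by linarith) (show (0 : ℤ) < β - 1 by omega)

lemma sum_erase_sub_sum_erase_le_sub_two (hA : G.IsAmplyRegularWith n d α β) (hαβ : α < β)
    (hα : 1 ≤ α) {x y : V} (hxy : G.Adj x y) {f : V → ℤ}
    (hf : ∀ u v, G.Adj u v → f v ≤ f u + 1) :
    ∑ v ∈ (G.neighborFinset y).erase x, f v - ∑ u ∈ (G.neighborFinset x).erase y, f u ≤ d - 2 := by
  have h := hA.sub_one_mul_sum_sub_sum_le hxy hf
  -- `α (β - α) - (β - 1) = (α - 1) (β - α - 1)`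
  have h₀ : (0 : ℤ) ≤ (α - 1) * (β - α - 1) := mul_nonneg (by omega) (by omega)
  exact le_of_mul_le_mul_left (by linarith) (show (0 : ℤ) < β - 1 by omega)

end IsAmplyRegularWith

/-- The discrete Bonnet–Myers theorem for a regular graph, with the curvature bound `c / d` on the
edges expressed through functions that increase by at most `1` along edges. -/
lemma mul_dist_le_two_mul (hG : G.Connected) {d : ℕ} (hd : G.IsRegularOfDegree d) {c : ℤ}
    (hc : ∀ f : V → ℤ, (∀ u v, G.Adj u v → f v ≤ f u + 1) → ∀ x y, G.Adj x y →
      ∑ v ∈ (G.neighborFinset y).erase x, f v - ∑ u ∈ (G.neighborFinset x).erase y, f u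
        ≤ d + 1 - c) (u v : V) :
    c * G.dist u v ≤ 2 * d := by
  have hlip : ∀ a b, G.Adj a b → (G.dist u b : ℤ) ≤ G.dist u a + 1 := fun a b hab => by
    have h := hG.dist_triangle (u := u) (v := a) (w := b)
    rw [dist_eq_one_iff_adj.mpr hab] at h
    exact_mod_cast h
  have hupper : ∀ (k : ℕ) (w : V), G.dist u w = k →
      ∑ z ∈ G.neighborFinset w, (G.dist u z : ℤ) ≤ d + (d - c) * k := by
    intro k
    induction k with
    | zero =>
      intro w hw
      obtain rfl : u = w := hG.dist_eq_zero_iff.mp hw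
      have hone : ∀ z ∈ G.neighborFinset u, (G.dist u z : ℤ) = 1 := fun z hz => by
        exact_mod_cast dist_eq_one_iff_adj.mpr ((G.mem_neighborFinset u z).mp hz)
      rw [sum_congr rfl hone]
      simp [hd u]
    | succ k ih =>
      intro w hw
      obtain ⟨w', hadj, hw'⟩ : ∃ w', G.Adj w' w ∧ G.dist u w' = k := by
        obtain ⟨p, hp⟩ := hG.exists_walk_length_eq_dist u w
        have hnil : ¬ p.Nil := fun h => by
          have := Walk.length_eq_zero_iff.mpr h
          omega
        have hadj := p.adj_penultimate hnil
        refine ⟨p.penultimate, hadj, ?_⟩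
        have h₁ := dist_le p.dropLast
        have h₂ := hlip _ _ hadj
        have h₃ : p.dropLast.length + 1 = p.length := Walk.length_dropLast_add_one hnil
        omega
      have hstep := hc (fun z => (G.dist u z : ℤ)) hlip w' w hadj
      have hsum₁ := sum_erase_add (G.neighborFinset w) (fun z => (G.dist u z : ℤ))
        ((G.mem_neighborFinset w w').mpr hadj.symm)
      have hsum₂ := sum_erase_add (G.neighborFinset w') (fun z => (G.dist u z : ℤ))
        ((G.mem_neighborFinset w' w).mpr hadj)
      have hprev := ih w' hw'
      rw [hw'] at hsum₁
      rw [hw] at hsum₂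
      push_cast at hsum₁ hsum₂ ⊢
      linarith
  have hlower : (d : ℤ) * (G.dist u v - 1) ≤ ∑ z ∈ G.neighborFinset v, (G.dist u z : ℤ) := by
    have h := card_nsmul_le_sum (G.neighborFinset v) (fun z => (G.dist u z : ℤ))
      (G.dist u v - 1) fun z hz => by
        have := hlip z v ((G.mem_neighborFinset v z).mp hz).symm
        linarith
    rwa [card_neighborFinset_eq_degree, hd v, nsmul_eq_mul] at h
  have := hupper _ v rfl
  linarith

end SimpleGraph

theorem corollary1p3 {V : Type*} [Fintype V] [DecidableEq V] (G : SimpleGraph V)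
    [DecidableRel G.Adj] (n d α β : ℕ) (hG : G.Connected)
    (hA : G.IsAmplyRegularWith n d α β) :
    (β ≠ 1 → α ≤ β → G.diam ≤ d) ∧
    (α < β → 1 ≤ α → G.diam ≤ ⌊(2 / 3 : ℚ) * (d : ℚ)⌋₊) := by
  have := hG.nonempty
  obtain ⟨u, v, huv⟩ := G.exists_dist_eq_diam
  rw [← huv]
  refine ⟨fun hβ hαβ => ?_, fun hαβ hα => Nat.le_floor ?_⟩
  · have h := SimpleGraph.mul_dist_le_two_mul hG hA.regular (c := 2) (fun f hf x y hxy =>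
      (hA.sum_erase_sub_sum_erase_le_sub_one hβ hαβ hxy hf).trans (by linarith)) u v
    omega
  · have h := SimpleGraph.mul_dist_le_two_mul hG hA.regular (c := 3) (fun f hf x y hxy =>
      (hA.sum_erase_sub_sum_erase_le_sub_two hαβ hα hxy hf).trans (by linarith)) u v
    have h' : (3 : ℚ) * G.dist u v ≤ 2 * d := by exact_mod_cast h
    linarith
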